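/- Let $n\ge 1$ and $1\le k\le n$ be integers, and use the convention $0^0=1$. (1) Let $A_1,\dots,A_n$ be complex Hermitian positive semidefinite $n\times n$ matrices which form a doubly-stochastic tuple, i.e. $\operatorname{tr}(A_i)=1$ for $1\le i\le n$ and $\sum_{i=1}^n A_i=I$. If $\operatorname{rank}(A_i)\le k$ for all $1\le i\le n$, then the mixed discriminant is a real number satisfying $$M(A_1,\dots,A_n):=\frac{\partial^n}{\partial x_1\cdots\partial x_n}\det\Big(\sum_{i=1}^n x_iA_i\Big)\ \ge\ \Big(\frac{k-1}{k}\Big)^{(k-1)(n-k)}\frac{k!}{k^k}.$$ (2) Let $A=(A(i,j))_{1\le i,j\le n}$ be a doubly-stochastic real matrix (nonnegative entries, all row and column sums equal to $1$). If $|\{j : A(i,j)>0\}|\le k$ for every $1\le i\le n-k$, then $$\operatorname{Per}(A)\ \ge\ \Big(\frac{k-1}{k}\Big)^{(k-1)(n-k)}\frac{k!}{k^k}.$$ -/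

import Mathlib

open scoped ComplexOrder

/-- The polynomial `det (∑ i, x_i A_i)` in the indeterminates `x_1, …, x_n`, for an
`n`-tuple `A` of complex `n × n` matrices. -/
noncomputable def detPolynomial {n : ℕ} (A : Fin n → Matrix (Fin n) (Fin n) ℂ) :
    MvPolynomial (Fin n) ℂ :=
  Matrix.det (∑ i : Fin n,
    (MvPolynomial.X i : MvPolynomial (Fin n) ℂ) • (A i).map (MvPolynomial.C (σ := Fin n)))

/-- The mixed discriminant `∂ⁿ/∂x_1 ⋯ ∂x_n det (∑ i, x_i A_i)`. The iterated derivative is a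
constant polynomial, since the determinant is homogeneous of degree `n`; its value is read off
at the origin. -/
noncomputable def mixedDiscriminant {n : ℕ} (A : Fin n → Matrix (Fin n) (Fin n) ℂ) : ℂ :=
  MvPolynomial.eval 0
    ((List.finRange n).foldr (fun i q => MvPolynomial.pderiv i q) (detPolynomial A))

/-- A doubly-stochastic `n`-tuple of `n × n` Hermitian positive semidefinite matrices:
each has trace one, and they sum to the identity. -/
structure IsDoublyStochasticTuple {n : ℕ} (A : Fin n → Matrix (Fin n) (Fin n) ℂ) : Prop where
  posSemidef : ∀ i, (A i).PosSemidef
  trace_eq_one : ∀ i, (A i).trace = 1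
  sum_eq_one : ∑ i, A i = 1

/-! The bound follows Gurvits' capacity method. For a doubly stochastic tuple `A` the polynomial
`p = det (∑ x_i A_i)` is homogeneous, has no zero when all `Re x_i > 0`
(`IsDoublyStochasticTuple.isStable`), and satisfies `p x ≥ ∏ x_i` for positive `x`
(`IsDoublyStochasticTuple.capacityGE_one`, weighted AM–GM for the eigenvalues). The mixed
discriminant is the coefficient of `x_0 ⋯ x_{n-1}` in `p`, which is extracted by replacing `p`
with `∂p/∂x_i` at `x_i = 0` for one variable after another.

Each such step keeps homogeneity and stability, and costs at most the factor
`G(k) = ((k - 1) / k) ^ (k - 1)` in the lower bound `C ∏ x_i`, where `k` bounds the degree in the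
variable removed. For the bound (`IsStable.capacityGE_coeff_one`): at positive values of the other
variables, homogeneity and stability make `R(t) = p (t, x)` a polynomial with nonpositive real roots,
so AM–GM bounds it by `R(0) (1 + t R'(0) / (k R(0))) ^ k`, and one compares with `C t` at the best
`t`. For stability (`IsStable.coeff_one`): the derivative is stable by Gauss–Lucas, and setting
the variable to zero is a limit, under which the inequality `|p (Re z)| ≤ |p z|`, valid for stable
homogeneous polynomials, persists.

The degree of `p` in `x_i` is at most `rank A_i`, and after `n - k` steps the total degree is `k`;
the factors `G(k) ^ (n - k)` and `G(k) ⋯ G(1) = k! / k ^ k` give the bound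
(`IsStable.le_coeff_one`). The permanent is the mixed discriminant of the diagonal matrices formed
from the rows, whose ranks are the numbers of positive entries, so both parts are instances of
`IsDoublyStochasticTuple.le_mixedDiscriminant`. -/

/-! ### Univariate polynomials with nonpositive real roots -/

/-- The arithmetic–geometric mean inequality for the factors `1 + a i`, padded with `k - card ι`
factors equal to `1`. -/
theorem prod_one_add_le_pow {ι : Type*} [Fintype ι] (a : ι → ℝ) (ha : ∀ i, 0 ≤ a i) (k : ℕ)
    (hk : 1 ≤ k) (hcard : Fintype.card ι ≤ k) :
    ∏ i, (1 + a i) ≤ (1 + (∑ i, a i) / k) ^ k := by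
  have hk0 : (0 : ℝ) < k := by exact_mod_cast hk
  have hc : (Fintype.card ι : ℝ) ≤ k := by exact_mod_cast hcard
  -- The weight of `none` accounts for all the factors `1` at once.
  let w : Option ι → ℝ := fun o => o.elim (((k : ℝ) - Fintype.card ι) / k) (fun _ => 1 / k)
  let z : Option ι → ℝ := fun o => o.elim 1 (fun i => 1 + a i)
  have key := Real.geom_mean_le_arith_mean_weighted Finset.univ w z
    (by
      rintro (_ | i) -
      · exact div_nonneg (by linarith) hk0.le
      · exact div_nonneg zero_le_one hk0.le)
    (by
      simp only [w, Fintype.sum_option, Option.elim, Finset.sum_const, Finset.card_univ,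
        nsmul_eq_mul]
      field_simp
      ring)
    (by
      rintro (_ | i) -
      · exact zero_le_one
      · exact add_nonneg zero_le_one (ha i))
  simp only [w, z, Fintype.sum_option, Fintype.prod_option, Option.elim, Real.one_rpow, one_mul,
    mul_one] at key
  have hpos : ∀ i, 0 ≤ 1 + a i := fun i => add_nonneg zero_le_one (ha i)
  have h1 : ∏ i, (1 + a i) = (∏ i, (1 + a i) ^ (1 / (k : ℝ))) ^ k := by
    rw [← Finset.prod_pow]
    refine Finset.prod_congr rfl fun i _ => ?_
    rw [one_div, Real.rpow_inv_natCast_pow (hpos i) (by omega)]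
  have h2 : ((k : ℝ) - Fintype.card ι) / k + ∑ i, 1 / (k : ℝ) * (1 + a i) =
      1 + (∑ i, a i) / k := by
    rw [← Finset.mul_sum, Finset.sum_add_distrib]
    simp only [Finset.sum_const, Finset.card_univ, nsmul_eq_mul, mul_one]
    field_simp
    ring
  rw [h1, ← h2]
  exact pow_le_pow_left₀ (Finset.prod_nonneg fun i _ => Real.rpow_nonneg (hpos i) _) key k

theorem Multiset.prod_one_add_le_pow (s : Multiset ℝ) (hs : ∀ a ∈ s, 0 ≤ a) (k : ℕ) (hk : 1 ≤ k)
    (hcard : s.card ≤ k) : (s.map (1 + ·)).prod ≤ (1 + s.sum / k) ^ k := by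
  have h := _root_.prod_one_add_le_pow (fun i : s => (i.1 : ℝ))
    (fun i => hs _ (Multiset.coe_mem (x := i))) k hk (by simpa using hcard)
  have h1 : ∏ i : s, (1 + (i.1 : ℝ)) = (s.map (1 + ·)).prod := by
    rw [Finset.prod, ← Multiset.map_univ s (1 + ·)]
  have h2 : ∑ i : s, (i.1 : ℝ) = s.sum := by
    rw [Finset.sum, Multiset.map_univ_coe]
  rwa [h1, h2] at h

/-- The factor `G(k) = ((k - 1) / k) ^ (k - 1)`: the smallest possible ratio of `R'(0)` to
`inf_{t > 0} R(t) / t` over the polynomials `R` of degree at most `k`, positive on `t > 0`, whose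
roots are real and nonpositive. In particular `G(1) = 0 ^ 0 = 1`. -/
noncomputable def gurvitsFactor (k : ℕ) : ℝ := (((k : ℝ) - 1) / k) ^ (k - 1)

theorem gurvitsFactor_pos {k : ℕ} (hk : 1 ≤ k) : 0 < gurvitsFactor k := by
  obtain rfl | h := hk.eq_or_lt
  · simp [gurvitsFactor]
  · have : (1 : ℝ) < k := by exact_mod_cast h
    exact pow_pos (div_pos (by linarith) (by linarith)) _

theorem gurvitsFactor_le_one {k : ℕ} (hk : 1 ≤ k) : gurvitsFactor k ≤ 1 := by
  have : (1 : ℝ) ≤ k := by exact_mod_cast hk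
  refine pow_le_one₀ (div_nonneg (by linarith) (by linarith)) ?_
  rw [div_le_one (by linarith)]
  linarith

/-- If the line `C t` stays below `c (1 + t a / k) ^ k` on `t > 0`, then the slope `c a` of the
latter at the origin is at least `C * G(k)`. -/
theorem mul_gurvitsFactor_le {C c a : ℝ} {k : ℕ} (hk : 1 ≤ k) (hC : 0 < C) (hc : 0 < c)
    (ha : 0 ≤ a) (h : ∀ t : ℝ, 0 < t → C * t ≤ c * (1 + t * a / k) ^ k) :
    C * gurvitsFactor k ≤ c * a := by
  have hk0 : (0 : ℝ) < k := by exact_mod_cast hk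
  obtain rfl | ha := ha.eq_or_lt
  · have := h (2 * c / C) (by positivity)
    rw [mul_div_cancel₀ _ hC.ne'] at this
    simp at this
    linarith
  obtain rfl | hk1 := hk.eq_or_lt
  · simp only [gurvitsFactor, Nat.sub_self, pow_zero, mul_one]
    by_contra! hlt
    -- Otherwise the two lines meet at `t = c / (C - c a)`, and the inequality fails beyond.
    have hd : 0 < C - c * a := by linarith
    have := h (2 * c / (C - c * a)) (by positivity)
    simp only [Nat.cast_one, div_one, pow_one] at this
    have e : (C - c * a) * (2 * c / (C - c * a)) = 2 * c := mul_div_cancel₀ _ hd.ne'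
    nlinarith
  · have hk2 : (1 : ℝ) < k := by exact_mod_cast hk1
    -- `t = k / (a (k - 1))` minimizes `(1 + t a / k) ^ k / t`.
    have h1 : (0 : ℝ) < k - 1 := by linarith
    have := h (k / (a * (k - 1))) (by positivity)
    have e : 1 + k / (a * (k - 1)) * a / k = (k : ℝ) / (k - 1) := by
      field_simp
      ring
    rw [e] at this
    obtain ⟨m, rfl⟩ : ∃ m, k = m + 1 := ⟨k - 1, by omega⟩
    simp only [gurvitsFactor, Nat.add_sub_cancel]
    push_cast at *
    simp only [add_sub_cancel_right] at *
    have hq : (0 : ℝ) < (m / (m + 1)) ^ m := by positivity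
    have := mul_le_mul_of_nonneg_right this
      (mul_pos hq (show (0 : ℝ) < a * m / (m + 1) by positivity)).le
    have e1 : C * ((m + 1) / (a * m)) * ((m / (m + 1)) ^ m * (a * m / (m + 1))) =
        C * ((m : ℝ) / (m + 1)) ^ m := by
      field_simp
    have e2 : c * (((m : ℝ) + 1) / m) ^ (m + 1) * ((m / (m + 1)) ^ m * (a * m / (m + 1))) =
        c * a := by
      rw [pow_succ]
      have : (((m : ℝ) + 1) / m) ^ m * (m / (m + 1)) ^ m = 1 := by
        rw [← mul_pow, div_mul_div_cancel₀ h1.ne', div_self hk0.ne', one_pow]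
      calc _ = c * a * ((((m : ℝ) + 1) / m) ^ m * (m / (m + 1)) ^ m) *
            ((((m : ℝ) + 1) / m) * (m / (m + 1))) := by ring
        _ = c * a := by rw [this]; field_simp
    linarith

theorem Complex.ofReal_multiset_prod (s : Multiset ℝ) :
    ((s.prod : ℝ) : ℂ) = (s.map (fun x : ℝ => (x : ℂ))).prod :=
  map_multiset_prod Complex.ofRealHom s

theorem Complex.ofReal_multiset_sum (s : Multiset ℝ) :
    ((s.sum : ℝ) : ℂ) = (s.map (fun x : ℝ => (x : ℂ))).sum :=
  map_multiset_sum Complex.ofRealHom s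

namespace Polynomial

theorem eval_eq_eval_zero_mul_prod_roots {R : ℂ[X]} (h0 : R.eval 0 ≠ 0) (t : ℂ) :
    R.eval t = R.eval 0 * (R.roots.map fun r => 1 - t / r).prod := by
  have hs := IsAlgClosed.splits R
  rw [hs.eval_eq_prod_roots t, hs.eval_eq_prod_roots 0, mul_assoc, ← Multiset.prod_map_mul]
  congr 2
  refine Multiset.map_congr rfl fun r hr => ?_
  have hr0 : r ≠ 0 := by
    rintro rfl
    exact h0 (isRoot_of_mem_roots hr)
  field_simp
  ring

theorem coeff_one_eq_eval_zero_mul_sum_roots {R : ℂ[X]} (h0 : R.eval 0 ≠ 0) :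
    R.coeff 1 = R.eval 0 * (R.roots.map fun r => -r⁻¹).sum := by
  have h := (IsAlgClosed.splits R).eval_derivative_div_eval_of_ne_zero h0
  rw [div_eq_iff h0, ← coeff_zero_eq_eval_zero, coeff_derivative] at h
  simp only [zero_add, Nat.cast_zero, mul_one, zero_sub, one_div] at h
  rw [h, mul_comm]
  simp only [inv_neg]

/-- Gurvits' univariate inequality: for a polynomial `R` of degree at most `k` whose roots are
real and nonpositive, a linear lower bound `C t ≤ R t` on `t > 0` forces `C * G(k) ≤ R'(0)`. -/
theorem mul_gurvitsFactor_le_coeff_one {R : ℂ[X]} {k : ℕ} (hk : 1 ≤ k) (hdeg : R.natDegree ≤ k)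
    (hroots : ∀ z, R.eval z = 0 → z ≤ 0) {C : ℝ} (hC : 0 < C)
    (hlow : ∀ t : ℝ, 0 < t → ((C * t : ℝ) : ℂ) ≤ R.eval (t : ℂ)) :
    ((C * gurvitsFactor k : ℝ) : ℂ) ≤ R.coeff 1 := by
  by_cases h0 : R.eval 0 = 0
  · -- `R t / t` extends to a polynomial whose value at `0` is `R'(0)`.
    obtain ⟨Q, rfl⟩ : X ∣ R := X_dvd_iff.2 (by rwa [coeff_zero_eq_eval_zero])
    rw [coeff_X_mul, coeff_zero_eq_eval_zero]
    have hQ : ∀ t : ℝ, 0 < t → ((C : ℝ) : ℂ) ≤ Q.eval (t : ℂ) := by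
      intro t ht
      have := hlow t ht
      rw [eval_mul, eval_X, mul_comm C t, Complex.ofReal_mul] at this
      exact le_of_mul_le_mul_left this (by exact_mod_cast ht)
    have hlim : Filter.Tendsto (fun t : ℝ => Q.eval (t : ℂ)) (nhdsWithin 0 (Set.Ioi 0))
        (nhds (Q.eval 0)) := by
      have hcont : Continuous fun t : ℝ => Q.eval (t : ℂ) :=
        Q.continuous.comp Complex.continuous_ofReal
      simpa using (hcont.tendsto 0).mono_left nhdsWithin_le_nhds
    have h1 : ((C : ℝ) : ℂ) ≤ Q.eval 0 :=
      ge_of_tendsto hlim (Filter.eventually_of_mem self_mem_nhdsWithin fun t ht => hQ t ht)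
    refine le_trans ?_ h1
    exact_mod_cast mul_le_of_le_one_right hC.le (gurvitsFactor_le_one hk)
  · let s : Multiset ℝ := R.roots.map fun r => -(r⁻¹).re
    have hcast : ∀ r ∈ R.roots, ((-(r⁻¹).re : ℝ) : ℂ) = -r⁻¹ ∧ 0 ≤ -(r⁻¹).re := by
      intro r hr
      have hr := hroots r (isRoot_of_mem_roots hr)
      obtain ⟨x, hx, rfl⟩ : ∃ x : ℝ, x ≤ 0 ∧ (x : ℂ) = r := by
        rw [Complex.le_def] at hr
        exact ⟨r.re, hr.1, Complex.ext rfl hr.2.symm⟩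
      rw [← Complex.ofReal_inv, Complex.ofReal_re]
      exact ⟨by push_cast; rfl, neg_nonneg.2 (inv_nonpos.2 hx)⟩
    have hs : ∀ a ∈ s, 0 ≤ a := by
      intro a ha
      obtain ⟨r, hr, rfl⟩ := Multiset.mem_map.1 ha
      exact (hcast r hr).2
    have hev : ∀ t : ℝ, R.eval (t : ℂ) = R.eval 0 * (((s.map (t * ·)).map (1 + ·)).prod : ℝ) := by
      intro t
      rw [eval_eq_eval_zero_mul_prod_roots h0, Multiset.map_map, Multiset.map_map,
        Complex.ofReal_multiset_prod, Multiset.map_map]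
      congr 2
      refine Multiset.map_congr rfl fun r hr => ?_
      simp only [Function.comp_apply, Complex.ofReal_add, Complex.ofReal_one, Complex.ofReal_mul,
        (hcast r hr).1]
      ring
    have hone : 0 < ((s.map ((1 : ℝ) * ·)).map (1 + ·)).prod := by
      refine Multiset.prod_induction (fun x : ℝ => 0 < x) _ (fun _ _ => mul_pos) one_pos ?_
      intro x hx
      simp only [one_mul, Multiset.map_id', Multiset.mem_map] at hx
      obtain ⟨a, ha, rfl⟩ := hx
      linarith [hs a ha]
    obtain ⟨c, hc, hc0⟩ : ∃ c : ℝ, 0 < c ∧ (c : ℂ) = R.eval 0 := by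
      have h1 := hlow 1 one_pos
      rw [hev 1, Complex.le_def] at h1
      simp only [Complex.re_mul_ofReal, Complex.im_mul_ofReal, Complex.ofReal_re,
        Complex.ofReal_im, mul_one] at h1
      have him : (R.eval 0).im = 0 :=
        (mul_eq_zero.1 h1.2.symm).resolve_right hone.ne'
      refine ⟨(R.eval 0).re, ?_, Complex.ext rfl (by simp [him])⟩
      exact pos_of_mul_pos_left (hC.trans_le h1.1) hone.le
    have hsum : R.coeff 1 = ((c * s.sum : ℝ) : ℂ) := by
      rw [coeff_one_eq_eval_zero_mul_sum_roots h0, Complex.ofReal_mul, hc0,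
        Complex.ofReal_multiset_sum, Multiset.map_map]
      congr 2
      exact Multiset.map_congr rfl fun r hr => ((hcast r hr).1).symm
    rw [hsum]
    refine Complex.real_le_real.2 (mul_gurvitsFactor_le hk hC hc (Multiset.sum_nonneg hs) ?_)
    intro t ht
    have h1 := hlow t ht
    rw [hev t, ← hc0, ← Complex.ofReal_mul, Complex.real_le_real] at h1
    refine h1.trans (mul_le_mul_of_nonneg_left ?_ hc.le)
    have := Multiset.prod_one_add_le_pow (s.map (t * ·)) (by
        intro a ha
        obtain ⟨b, hb, rfl⟩ := Multiset.mem_map.1 ha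
        exact mul_nonneg ht.le (hs b hb)) k hk (by
        simp only [s, Multiset.card_map]
        exact (card_roots' R).trans hdeg)
    rwa [Multiset.sum_map_mul_left, Multiset.map_id'] at this

end Polynomial

/-! ### Stable homogeneous polynomials -/

namespace MvPolynomial

/-- A complex polynomial is *stable* if it has no zero in the product of the open right
half-planes. -/
def IsStable {σ : Type*} (p : MvPolynomial σ ℂ) : Prop :=
  ∀ z : σ → ℂ, (∀ i, 0 < (z i).re) → eval z p ≠ 0

theorem IsHomogeneous.eval_smul_apply {σ R : Type*} [CommSemiring R] {p : MvPolynomial σ R}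
    {d : ℕ} (hp : p.IsHomogeneous d) (c : R) (z : σ → R) :
    eval (fun i => c * z i) p = c ^ d * eval z p := by
  rw [eval_eq, eval_eq, Finset.mul_sum]
  refine Finset.sum_congr rfl fun m hm => ?_
  have hdeg : ∑ i ∈ m.support, m i = d := by
    have := hp (mem_support_iff.1 hm)
    simpa [Finsupp.weight_apply, Finsupp.sum] using this
  simp only [mul_pow, Finset.prod_mul_distrib, Finset.prod_pow_eq_pow_sum, hdeg]
  ring

/-- On the right half-planes the modulus of a stable homogeneous polynomial does not increase when
imaginary parts are dropped. The reason: `s ↦ p (x + s i y)` has purely imaginary zeros `ρ`, and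
`‖1 - 1/ρ‖ ≥ 1` for those. This closed condition replaces Hurwitz' theorem when passing to limits
of stable polynomials. -/
theorem IsStable.norm_eval_re_le {σ : Type*} {p : MvPolynomial σ ℂ} {d : ℕ} (hs : p.IsStable)
    (hp : p.IsHomogeneous d) (z : σ → ℂ) (hz : ∀ i, 0 < (z i).re) :
    ‖eval (fun i => ((z i).re : ℂ)) p‖ ≤ ‖eval z p‖ := by
  let G : Polynomial ℂ := aeval (fun i => Polynomial.C ((z i).re : ℂ) +
    Polynomial.X * Polynomial.C (Complex.I * (z i).im)) p
  have hG : ∀ s : ℂ, G.eval s = eval (fun i => (z i).re + s * (Complex.I * (z i).im)) p := by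
    intro s
    have h := eval₂_comp_left (Polynomial.evalRingHom s) (algebraMap ℂ (Polynomial ℂ))
      (fun i => Polynomial.C ((z i).re : ℂ) + Polynomial.X * Polynomial.C (Complex.I * (z i).im)) p
    rw [Polynomial.coe_evalRingHom] at h
    rw [show G = eval₂ (algebraMap ℂ (Polynomial ℂ)) _ p from rfl, h, ← coe_eval₂Hom, eval]
    congr 2
    · ext a
      simp
    · ext i
      simp
  have h0 : G.eval 0 = eval (fun i => ((z i).re : ℂ)) p := by
    rw [hG]
    simp
  have h1 : G.eval 1 = eval z p := by
    rw [hG]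
    have e : (fun i => ((z i).re : ℂ) + 1 * (Complex.I * (z i).im)) = z := by
      ext i
      rw [one_mul, mul_comm Complex.I, Complex.re_add_im]
    rw [e]
  have hG0 : G.eval 0 ≠ 0 := by
    rw [h0]
    exact hs _ fun i => by simpa using hz i
  have himag : ∀ r : ℂ, G.eval r = 0 → r.re = 0 := by
    intro r hr
    rw [hG] at hr
    -- Multiplying by `± conj r` moves the zero into the right half-planes.
    have hmul : ∀ c : ℂ, eval (fun i => c * ((z i).re + r * (Complex.I * (z i).im))) p = 0 := by
      intro c
      rw [hp.eval_smul_apply, hr, mul_zero]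
    rcases lt_trichotomy r.re 0 with h | h | h
    · refine absurd (hmul (-(starRingEnd ℂ) r)) (hs _ fun i => ?_)
      have := mul_pos_of_neg_of_neg h (neg_neg_of_pos (hz i))
      simp
      nlinarith
    · exact h
    · refine absurd (hmul ((starRingEnd ℂ) r)) (hs _ fun i => ?_)
      have := mul_pos h (hz i)
      simp
      nlinarith
  rw [← h0, ← h1, Polynomial.eval_eq_eval_zero_mul_prod_roots hG0 1, norm_mul]
  refine le_mul_of_one_le_right (norm_nonneg _) ?_
  refine Multiset.prod_induction (fun w : ℂ => 1 ≤ ‖w‖) _ ?_ (by simp) ?_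
  · intro a b ha hb
    rw [norm_mul]
    exact one_le_mul_of_one_le_of_one_le ha hb
  · intro w hw
    obtain ⟨r, hr, rfl⟩ := Multiset.mem_map.1 hw
    have hr := himag r (Polynomial.isRoot_of_mem_roots hr)
    have : (1 - 1 / r).re = 1 := by simp [Complex.inv_re, hr]
    calc (1 : ℝ) = |(1 - 1 / r).re| := by rw [this, abs_one]
      _ ≤ _ := Complex.abs_re_le_norm _

/-- The capacity `inf_{x > 0} p x / ∏ x_i` of `p` is at least `C`. The inequality in the order of
`ℂ` includes that `p x` is real for positive `x`. -/
def CapacityGE {n : ℕ} (C : ℝ) (p : MvPolynomial (Fin n) ℂ) : Prop :=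
  ∀ x : Fin n → ℝ, (∀ i, 0 < x i) → ((C * ∏ i, x i : ℝ) : ℂ) ≤ eval (fun i => (x i : ℂ)) p

section Slice

variable {n : ℕ}

/-- The restriction of `p` to the line where the first variable is free and the others are
fixed to `z`. -/
noncomputable def slice (p : MvPolynomial (Fin (n + 1)) ℂ) (z : Fin n → ℂ) : Polynomial ℂ :=
  (finSuccEquiv ℂ n p).map (eval z)

theorem eval_slice (p : MvPolynomial (Fin (n + 1)) ℂ) (z : Fin n → ℂ) (t : ℂ) :
    (slice p z).eval t = eval (Fin.cons t z : Fin (n + 1) → ℂ) p :=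
  (eval_eq_eval_mv_eval' z t p).symm

theorem coeff_slice (p : MvPolynomial (Fin (n + 1)) ℂ) (z : Fin n → ℂ) (i : ℕ) :
    (slice p z).coeff i = eval z ((finSuccEquiv ℂ n p).coeff i) := by
  rw [slice, Polynomial.coeff_map]

theorem natDegree_slice_le (p : MvPolynomial (Fin (n + 1)) ℂ) (z : Fin n → ℂ) :
    (slice p z).natDegree ≤ degreeOf 0 p :=
  Polynomial.natDegree_map_le.trans (natDegree_finSuccEquiv p).le

theorem finSuccEquiv_pderiv_zero (p : MvPolynomial (Fin (n + 1)) ℂ) :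
    finSuccEquiv ℂ n (pderiv 0 p) = (finSuccEquiv ℂ n p).derivative := by
  ext i m
  rw [finSuccEquiv_coeff_coeff, coeff_pderiv, Polynomial.coeff_derivative]
  have h : m.cons i + Finsupp.single 0 1 = m.cons (i + 1) := by
    ext j
    refine Fin.cases ?_ (fun j => ?_) j <;> simp
  rw [h, Finsupp.cons_zero, ← finSuccEquiv_coeff_coeff]
  have h2 : ((i : MvPolynomial (Fin n) ℂ) + 1) = C ((i : ℂ) + 1) := by simp
  rw [h2, mul_comm _ (C _), coeff_C_mul, mul_comm]

theorem slice_pderiv_zero (p : MvPolynomial (Fin (n + 1)) ℂ) (z : Fin n → ℂ) :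
    slice (pderiv 0 p) z = (slice p z).derivative := by
  rw [slice, slice, finSuccEquiv_pderiv_zero, Polynomial.derivative_map]

variable {p : MvPolynomial (Fin (n + 1)) ℂ}

theorem IsStable.eval_slice_ne_zero (hs : p.IsStable) {z : Fin n → ℂ} (hz : ∀ i, 0 < (z i).re)
    {t : ℂ} (ht : 0 < t.re) : (slice p z).eval t ≠ 0 := by
  rw [eval_slice]
  exact hs _ (Fin.cases ht hz)

/-- For positive `x` the zeros of `t ↦ p (t, x)` are real and nonpositive: any other `t` can be
rotated, together with `x`, into the right half-plane. -/
theorem IsStable.root_slice_le_zero (hs : p.IsStable) {d : ℕ} (hp : p.IsHomogeneous d)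
    {x : Fin n → ℝ} (hx : ∀ i, 0 < x i) (t : ℂ)
    (ht : (slice p fun i => (x i : ℂ)).eval t = 0) : t ≤ 0 := by
  by_contra hneg
  have hslit : t ∈ Complex.slitPlane := by
    rw [Complex.mem_slitPlane_iff]
    by_contra! h
    exact hneg (Complex.le_def.2 ⟨h.1, h.2⟩)
  have hre : 0 < t.re + ‖t‖ := by
    have h1 := Complex.abs_re_le_norm t
    rcases Complex.mem_slitPlane_iff.1 hslit with h | h
    · have := norm_nonneg t
      linarith
    · have h2 : |t.re| < ‖t‖ := Complex.abs_re_lt_norm.2 h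
      have := neg_abs_le t.re
      linarith
  rw [eval_slice] at ht
  have h0 := hp.eval_smul_apply ((starRingEnd ℂ) t + ‖t‖) (Fin.cons t fun i => (x i : ℂ))
  rw [ht, mul_zero] at h0
  refine hs _ (Fin.cases ?_ fun i => ?_) h0
  · have hn : 0 < ‖t‖ := by
      rw [norm_pos_iff]
      exact Complex.slitPlane_ne_zero hslit
    have hsq : t.re * t.re + t.im * t.im = ‖t‖ * ‖t‖ := by
      rw [← Complex.normSq_apply, Complex.normSq_eq_norm_sq, sq]
    have := mul_pos hn hre
    simp
    nlinarith
  · have := mul_pos hre (hx i)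
    simpa using this

/-- If a stable polynomial has positive capacity, its slices over the right half-planes are not
constant, hence by Gauss–Lucas the derivative in the first variable is stable. -/
theorem IsStable.pderiv_zero (hs : p.IsStable) {d : ℕ} (hp : p.IsHomogeneous d) {C : ℝ}
    (hC : 0 < C) (hcap : CapacityGE C p) : (pderiv 0 p).IsStable := by
  intro w hw
  obtain ⟨t, z, rfl⟩ : ∃ t z, w = Fin.cons t z := ⟨w 0, Fin.tail w, (Fin.cons_self_tail w).symm⟩
  have ht : 0 < t.re := hw 0
  have hz : ∀ i, 0 < (z i).re := fun i => by simpa using hw i.succ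
  rw [← eval_slice, slice_pderiv_zero]
  intro hder
  have hgrow : ∀ s : ℝ, 0 < s → C * (s * ∏ i, (z i).re) ≤ ‖(slice p z).eval (s : ℂ)‖ := by
    intro s hsp
    have h1 := hs.norm_eval_re_le hp (Fin.cons (s : ℂ) z)
      (Fin.cases (by simpa using hsp) fun i => by simpa using hz i)
    rw [← eval_slice] at h1
    refine le_trans ?_ h1
    have h2 := hcap (Fin.cons s fun i => (z i).re) (Fin.cases hsp hz)
    rw [Fin.prod_univ_succ] at h2
    simp only [Fin.cons_zero, Fin.cons_succ] at h2
    have e : (fun i => (((Fin.cons s fun i => (z i).re : Fin (n + 1) → ℝ) i : ℝ) : ℂ)) =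
        fun i => (((Fin.cons (s : ℂ) z : Fin (n + 1) → ℂ) i).re : ℂ) := by
      ext i
      refine Fin.cases ?_ (fun i => ?_) i <;> simp
    rw [e] at h2
    exact (Complex.le_def.1 h2).1.trans (Complex.re_le_norm _)
  have hdeg : 0 < (slice p z).degree := by
    by_contra hle
    rw [not_lt] at hle
    rw [Polynomial.eq_C_of_degree_le_zero hle] at hgrow
    simp only [Polynomial.eval_C] at hgrow
    set M := ‖(slice p z).coeff 0‖
    have hP : 0 < ∏ i, (z i).re := Finset.prod_pos fun i _ => hz i
    have := hgrow ((M + 1) / (C * ∏ i, (z i).re)) (by positivity)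
    have e : C * ((M + 1) / (C * ∏ i, (z i).re) * ∏ i, (z i).re) = M + 1 := by
      field_simp
    linarith
  have hmem := Polynomial.rootSet_derivative_subset_convexHull_rootSet hdeg
    (show t ∈ (slice p z).derivative.rootSet ℂ by
      rw [Polynomial.mem_rootSet]
      refine ⟨fun h => ?_, by simpa using hder⟩
      have := Polynomial.derivative_eq_zero.1 h
      rw [← Polynomial.natDegree_pos_iff_degree_pos] at hdeg
      omega)
  have hsub : convexHull ℝ ((slice p z).rootSet ℂ) ⊆ {s : ℂ | s.re ≤ 0} := by
    refine convexHull_min (fun s hs' => ?_) (convex_halfSpace_re_le 0)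
    by_contra hpos
    rw [Set.mem_ofPred_eq, not_le] at hpos
    exact hs.eval_slice_ne_zero hz hpos (by simpa using (Polynomial.mem_rootSet.1 hs').2)
  exact absurd (hsub hmem) (not_le.2 ht)

/-- Gurvits' inequality: passing from `p` to `∂p/∂x_0` at `x_0 = 0` costs at most a factor
`G(k)` of the capacity, `k` bounding the degree of `p` in `x_0`. -/
theorem IsStable.capacityGE_coeff_one (hs : p.IsStable) {d : ℕ} (hp : p.IsHomogeneous d) {C : ℝ}
    (hC : 0 < C) (hcap : CapacityGE C p) {k : ℕ} (hk : 1 ≤ k) (hdeg : degreeOf 0 p ≤ k) :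
    CapacityGE (C * gurvitsFactor k) ((finSuccEquiv ℂ n p).coeff 1) := by
  intro x hx
  rw [← coeff_slice, mul_right_comm]
  refine Polynomial.mul_gurvitsFactor_le_coeff_one hk ((natDegree_slice_le _ _).trans hdeg)
    (hs.root_slice_le_zero hp hx) (mul_pos hC (Finset.prod_pos fun i _ => hx i)) fun t ht => ?_
  have h := hcap (Fin.cons t x) (Fin.cases ht hx)
  rw [Fin.prod_univ_succ] at h
  simp only [Fin.cons_zero, Fin.cons_succ] at h
  have e : (fun i => (((Fin.cons t x : Fin (n + 1) → ℝ) i : ℝ) : ℂ)) =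
      Fin.cons (t : ℂ) fun i => (x i : ℂ) := by
    ext i
    refine Fin.cases ?_ (fun i => ?_) i <;> simp
  rw [e, ← eval_slice] at h
  convert h using 2
  ring

theorem IsStable.coeff_one (hs : p.IsStable) {d : ℕ} (hp : p.IsHomogeneous d) {C : ℝ}
    (hC : 0 < C) (hcap : CapacityGE C p) : ((finSuccEquiv ℂ n p).coeff 1).IsStable := by
  intro z hz
  have hs' := hs.pderiv_zero hp hC hcap
  have hp' := hp.pderiv (i := (0 : Fin (n + 1)))
  -- Let the first variable tend to `0` in `‖∂p(t, Re z)‖ ≤ ‖∂p(t, z)‖`.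
  have hlim : ∀ y : Fin n → ℂ, Filter.Tendsto
      (fun t : ℝ => ‖(slice (pderiv 0 p) y).eval (t : ℂ)‖) (nhdsWithin 0 (Set.Ioi 0))
      (nhds ‖eval y ((finSuccEquiv ℂ n p).coeff 1)‖) := by
    intro y
    have hcont : Continuous fun t : ℝ => ‖(slice (pderiv 0 p) y).eval (t : ℂ)‖ :=
      ((slice (pderiv 0 p) y).continuous.comp Complex.continuous_ofReal).norm
    have h0 : (slice (pderiv 0 p) y).eval 0 = eval y ((finSuccEquiv ℂ n p).coeff 1) := by
      rw [slice_pderiv_zero, ← Polynomial.coeff_zero_eq_eval_zero, Polynomial.coeff_derivative,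
        ← coeff_slice]
      simp
    simpa [h0] using (hcont.tendsto 0).mono_left nhdsWithin_le_nhds
  have hle : ‖eval (fun i => ((z i).re : ℂ)) ((finSuccEquiv ℂ n p).coeff 1)‖ ≤
      ‖eval z ((finSuccEquiv ℂ n p).coeff 1)‖ := by
    refine le_of_tendsto_of_tendsto (hlim _) (hlim _) ?_
    filter_upwards [self_mem_nhdsWithin] with t ht
    have ht : 0 < t := ht
    have := hs'.norm_eval_re_le hp' (Fin.cons (t : ℂ) z)
      (Fin.cases (by simpa using ht) fun i => by simpa using hz i)
    have e : (fun i => (((Fin.cons (t : ℂ) z : Fin (n + 1) → ℂ) i).re : ℂ)) =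
        Fin.cons (t : ℂ) fun i => ((z i).re : ℂ) := by
      ext i
      refine Fin.cases ?_ (fun i => ?_) i <;> simp
    rwa [e, ← eval_slice, ← eval_slice] at this
  -- Only the positivity of the real values matters here, so any bound for the degree will do.
  have hpos := hs.capacityGE_coeff_one hp hC hcap (k := degreeOf 0 p + 1) (by omega) (by omega)
    (fun i => (z i).re) hz
  have hpos' : 0 < C * gurvitsFactor (degreeOf 0 p + 1) * ∏ i, (z i).re :=
    mul_pos (mul_pos hC (gurvitsFactor_pos (by omega))) (Finset.prod_pos fun i _ => hz i)
  have := hpos'.trans_le ((Complex.le_def.1 hpos).1.trans (Complex.re_le_norm _))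
  exact norm_pos_iff.1 (this.trans_le hle)

end Slice

theorem gurvitsFactor_mul_factorial_div (n : ℕ) :
    gurvitsFactor (n + 1) * ((n.factorial : ℝ) / (n : ℝ) ^ n) =
      ((n + 1).factorial : ℝ) / ((n + 1 : ℕ) : ℝ) ^ (n + 1) := by
  rcases Nat.eq_zero_or_pos n with rfl | h
  · simp [gurvitsFactor]
  · have : (0 : ℝ) < n := by exact_mod_cast h
    simp only [gurvitsFactor, Nat.add_sub_cancel, Nat.factorial_succ]
    push_cast
    rw [add_sub_cancel_right, div_pow, pow_succ]
    field_simp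

/-- Eliminating the variables one after another: the first `n - k` cost a factor `G(k)` each, the
last `k` cost `G(k), G(k - 1), …, G(1)`, as then the total degree bounds the degree in a
variable, and `∏ i ≤ k, G(i) = k! / k ^ k`. -/
theorem IsStable.le_coeff_one {n : ℕ} {p : MvPolynomial (Fin n) ℂ} (hs : p.IsStable)
    (hp : p.IsHomogeneous n) {C : ℝ} (hC : 0 < C) (hcap : CapacityGE C p) {k : ℕ} (hkn : k ≤ n)
    (hk : n = 0 ∨ 1 ≤ k) (hdeg : ∀ i : Fin n, (i : ℕ) < n - k → degreeOf i p ≤ k) :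
    ((C * (gurvitsFactor k ^ (n - k) * ((k.factorial : ℝ) / (k : ℝ) ^ k)) : ℝ) : ℂ) ≤
      coeff (Finsupp.equivFunOnFinite.symm fun _ => 1) p := by
  induction n generalizing C k with
  | zero =>
    obtain rfl : k = 0 := by omega
    have h := hcap Fin.elim0 (fun i => i.elim0)
    rw [eq_C_of_isEmpty p] at h ⊢
    rw [Subsingleton.elim (Finsupp.equivFunOnFinite.symm fun _ => 1) (0 : Fin 0 →₀ ℕ)]
    simpa using h
  | succ n ih =>
    have hk : 1 ≤ k := by omega
    have hcons : coeff (Finsupp.equivFunOnFinite.symm fun _ => 1) p =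
        coeff (Finsupp.equivFunOnFinite.symm fun _ => 1) ((finSuccEquiv ℂ n p).coeff 1) := by
      rw [finSuccEquiv_coeff_coeff]
      congr 1
      ext j
      refine Fin.cases ?_ (fun j => ?_) j <;> simp
    rw [hcons]
    have hs' := hs.coeff_one hp hC hcap
    have hp' := hp.finSuccEquiv_coeff_isHomogeneous 1 n (by omega)
    rcases Nat.lt_or_ge n k with hlt | hle
    · obtain rfl : k = n + 1 := by omega
      have hcap' := hs.capacityGE_coeff_one hp hC hcap hk
        ((degreeOf_le_totalDegree p 0).trans hp.totalDegree_le)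
      have := ih hs' hp' (mul_pos hC (gurvitsFactor_pos hk)) hcap' le_rfl (by omega)
        (fun i hi => by omega)
      simpa only [Nat.sub_self, pow_zero, one_mul, mul_assoc,
        gurvitsFactor_mul_factorial_div] using this
    · have hcap' := hs.capacityGE_coeff_one hp hC hcap hk (hdeg 0 (by simp; omega))
      have := ih hs' hp' (mul_pos hC (gurvitsFactor_pos hk)) hcap' hle (by omega)
        (fun i hi => (degreeOf_coeff_finSuccEquiv p i 1).trans
          (hdeg i.succ (by rw [Fin.val_succ]; omega)))
      rw [show n + 1 - k = n - k + 1 by omega, pow_succ']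
      simpa only [mul_assoc] using this

end MvPolynomial

/-! ### The mixed discriminant as a coefficient -/

theorem MvPolynomial.coeff_foldr_pderiv {σ R : Type*} [CommSemiring R] [DecidableEq σ]
    (p : MvPolynomial σ R) {l : List σ} (hl : l.Nodup) {m : σ →₀ ℕ} (hm : ∀ i ∈ l, m i = 0) :
    coeff m (l.foldr (fun i q => pderiv i q) p) =
      coeff (m + ∑ i ∈ l.toFinset, Finsupp.single i 1) p := by
  induction l generalizing m with
  | nil => simp
  | cons a l ih =>
    rw [List.nodup_cons] at hl
    rw [List.foldr_cons, coeff_pderiv, ih hl.2, hm a (by simp), List.toFinset_cons,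
      Finset.sum_insert (by simpa using hl.1), add_assoc]
    · simp
    · intro i hi
      have : a ≠ i := by
        rintro rfl
        exact hl.1 hi
      simp [hm i (by simp [hi]), this]

theorem mixedDiscriminant_eq_coeff {n : ℕ} (A : Fin n → Matrix (Fin n) (Fin n) ℂ) :
    mixedDiscriminant A =
      MvPolynomial.coeff (Finsupp.equivFunOnFinite.symm fun _ => 1) (detPolynomial A) := by
  rw [mixedDiscriminant, ← MvPolynomial.coe_aeval_eq_eval, RingHom.coe_coe,
    MvPolynomial.aeval_zero, Algebra.algebraMap_self_apply, MvPolynomial.constantCoeff_eq,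
    MvPolynomial.coeff_foldr_pderiv _ (List.nodup_finRange n) (by simp), zero_add]
  congr 1
  ext j
  simp [Finsupp.finsetSum_apply, Finsupp.single_apply]

/-! ### Determinantal polynomials of positive semidefinite tuples -/

section DetPolynomial

open MvPolynomial

variable {n : ℕ}

theorem eval_detPolynomial (A : Fin n → Matrix (Fin n) (Fin n) ℂ) (z : Fin n → ℂ) :
    eval z (detPolynomial A) = (∑ i, z i • A i).det := by
  rw [detPolynomial, RingHom.map_det]
  congr 1
  ext a b
  simp [Matrix.sum_apply]

theorem detPolynomial_apply (A : Fin n → Matrix (Fin n) (Fin n) ℂ) :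
    detPolynomial A = ∑ s : Equiv.Perm (Fin n), C ((Equiv.Perm.sign s : ℤ) : ℂ) *
      ∏ j, ∑ i, X i * C (A i (s j) j) := by
  rw [detPolynomial, Matrix.det_apply']
  simp [Matrix.sum_apply]

theorem isHomogeneous_detPolynomial (A : Fin n → Matrix (Fin n) (Fin n) ℂ) :
    (detPolynomial A).IsHomogeneous n := by
  rw [detPolynomial_apply]
  refine IsHomogeneous.sum _ _ _ fun s _ => ?_
  have h : (∏ j, ∑ i, X i * C (A i (s j) j)).IsHomogeneous (∑ _j : Fin n, 1) := by
    refine IsHomogeneous.prod _ _ _ fun j _ => IsHomogeneous.sum _ _ _ fun i _ => ?_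
    exact (isHomogeneous_X ℂ i).mul (isHomogeneous_C _ _)
  simpa using (isHomogeneous_C (Fin n) ((Equiv.Perm.sign s : ℤ) : ℂ)).mul h

theorem detPolynomial_conj (A : Fin n → Matrix (Fin n) (Fin n) ℂ)
    {V U : Matrix (Fin n) (Fin n) ℂ} (h : V * U = 1) :
    detPolynomial (fun i => V * A i * U) = detPolynomial A := by
  have hsum : ∑ i, (X i : MvPolynomial (Fin n) ℂ) • (V * A i * U).map (C (σ := Fin n)) =
      V.map C * (∑ i, (X i : MvPolynomial (Fin n) ℂ) • (A i).map (C (σ := Fin n))) * U.map C := by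
    simp only [Matrix.map_mul, Matrix.mul_sum, Matrix.sum_mul, Matrix.mul_smul, Matrix.smul_mul]
  have hdet : (V.map (C (σ := Fin n))).det * (U.map (C (σ := Fin n))).det = 1 := by
    rw [← Matrix.det_mul, ← Matrix.map_mul, h, Matrix.map_one _ (map_zero C) (map_one C), Matrix.det_one]
  rw [detPolynomial, hsum, Matrix.det_mul, Matrix.det_mul, mul_right_comm, hdet, one_mul,
    detPolynomial]

/-- After diagonalizing `A i`, the variable `x_i` occurs only in the columns of the nonzero
eigenvalues. -/
theorem degreeOf_detPolynomial_le_rank (A : Fin n → Matrix (Fin n) (Fin n) ℂ) (i : Fin n)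
    (hA : (A i).IsHermitian) : degreeOf i (detPolynomial A) ≤ (A i).rank := by
  let U : Matrix (Fin n) (Fin n) ℂ := hA.eigenvectorUnitary
  have hdiag : star U * A i * U = Matrix.diagonal (RCLike.ofReal ∘ hA.eigenvalues) := by
    rw [← hA.conjStarAlgAut_star_eigenvectorUnitary, Unitary.conjStarAlgAut_star_apply]
  rw [← detPolynomial_conj A (V := star U) (U := U) (Unitary.coe_star_mul_self _),
    detPolynomial_apply]
  refine (degreeOf_sum_le i _ _).trans (Finset.sup_le fun s _ => ?_)
  refine (degreeOf_mul_le i _ _).trans ?_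
  rw [degreeOf_C, zero_add]
  refine (degreeOf_prod_le i _ _).trans ?_
  have hcol : ∀ j, degreeOf i (∑ m, X m * C ((star U * A m * U) (s j) j)) ≤
      if hA.eigenvalues j ≠ 0 then 1 else 0 := by
    intro j
    refine (degreeOf_sum_le i _ _).trans (Finset.sup_le fun m _ => ?_)
    by_cases hm : m = i
    · subst hm
      split_ifs with hj
      · refine (degreeOf_mul_le m _ _).trans ?_
        simp
      · rw [hdiag, Matrix.diagonal_apply]
        simp only [ne_eq, not_not] at hj
        split_ifs with hsj
        · simp [hsj, hj]
        · simp
    · refine (degreeOf_mul_le i _ _).trans ?_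
      rw [degreeOf_C, degreeOf_X_of_ne (Ne.symm hm)]
      simp
  refine (Finset.sum_le_sum fun j _ => hcol j).trans ?_
  rw [hA.rank_eq_card_non_zero_eigs, Fintype.card_subtype, Finset.card_filter]

variable {A : Fin n → Matrix (Fin n) (Fin n) ℂ}

/-- If `∑ z_i A_i` kills `v`, then `∑ Re z_i (v* A_i v) = 0`, which forces every `v* A_i v`, and
hence their sum `v* v`, to vanish. -/
theorem IsDoublyStochasticTuple.isStable (hA : IsDoublyStochasticTuple A) :
    (detPolynomial A).IsStable := by
  intro z hz h
  rw [eval_detPolynomial, ← Matrix.exists_mulVec_eq_zero_iff] at h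
  obtain ⟨v, hv, hv0⟩ := h
  have hq : ∀ i, 0 ≤ star v ⬝ᵥ (A i).mulVec v := fun i => (hA.posSemidef i).dotProduct_mulVec_nonneg v
  have hsum : ∑ i, z i * (star v ⬝ᵥ (A i).mulVec v) = 0 := by
    have := congrArg (fun w => star v ⬝ᵥ w) hv0
    simpa only [Matrix.sum_mulVec, dotProduct_sum, Matrix.smul_mulVec, dotProduct_smul,
      smul_eq_mul, dotProduct_zero] using this
  have hre : ∑ i, (z i).re * (star v ⬝ᵥ (A i).mulVec v).re = 0 := by
    have := congrArg Complex.re hsum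
    rw [Complex.re_sum, Complex.zero_re] at this
    rw [← this]
    refine Finset.sum_congr rfl fun i _ => ?_
    rw [Complex.mul_re, ← (Complex.le_def.1 (hq i)).2, Complex.zero_im, mul_zero, sub_zero]
  have hq0 : ∀ i, star v ⬝ᵥ (A i).mulVec v = 0 := by
    intro i
    have := (Finset.sum_eq_zero_iff_of_nonneg (fun i _ =>
      mul_nonneg (hz i).le (Complex.le_def.1 (hq i)).1)).1 hre i (Finset.mem_univ i)
    exact Complex.ext ((mul_eq_zero.1 this).resolve_left (hz i).ne')
      (Complex.le_def.1 (hq i)).2.symm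
  have h0 : star v ⬝ᵥ v = 0 := by
    calc star v ⬝ᵥ v = star v ⬝ᵥ (∑ i, A i).mulVec v := by rw [hA.sum_eq_one, Matrix.one_mulVec]
      _ = 0 := by
        rw [Matrix.sum_mulVec, dotProduct_sum]
        exact Finset.sum_eq_zero fun i _ => hq0 i
  exact hv (dotProduct_star_self_eq_zero.1 h0)

/-- In an eigenbasis `U` of `H = ∑ x_i A_i`, the eigenvalues of `H` are the averages
`∑ i, B i j * x_i`, where `B i j = (U* A_i U) j j` is doubly stochastic; weighted
arithmetic–geometric mean inequalities bound their product below by `∏ x_i`. -/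
theorem IsDoublyStochasticTuple.capacityGE_one (hA : IsDoublyStochasticTuple A) :
    CapacityGE 1 (detPolynomial A) := by
  intro x hx
  rw [eval_detPolynomial, one_mul]
  have hH : (∑ i, (x i : ℂ) • A i).IsHermitian := by
    refine (Matrix.posSemidef_sum _ fun i _ => (hA.posSemidef i).smul ?_).isHermitian
    exact_mod_cast (hx i).le
  let U : Matrix (Fin n) (Fin n) ℂ := hH.eigenvectorUnitary
  let B : Fin n → Fin n → ℝ := fun i j => ((star U * A i * U) j j).re
  have hpsd : ∀ i, (star U * A i * U).PosSemidef := fun i =>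
    (hA.posSemidef i).conjTranspose_mul_mul_same U
  have hB0 : ∀ i j, 0 ≤ B i j := fun i j => (Complex.le_def.1 (hpsd i).diag_nonneg).1
  have hcol : ∀ j, ∑ i, B i j = 1 := by
    intro j
    have : ∑ i, star U * A i * U = 1 := by
      rw [← Matrix.sum_mul, ← Matrix.mul_sum, hA.sum_eq_one, mul_one]
      exact Unitary.coe_star_mul_self _
    have := congrArg (fun M => (M j j).re) this
    simpa [B, Matrix.sum_apply] using this
  have hrow : ∀ i, ∑ j, B i j = 1 := by
    intro i
    have hU : U * star U = 1 := Unitary.coe_mul_star_self _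
    have : (star U * A i * U).trace = 1 := by
      rw [Matrix.trace_mul_comm, ← mul_assoc, hU, one_mul, hA.trace_eq_one]
    have := congrArg Complex.re this
    simpa [B, Matrix.trace] using this
  have heig : ∀ j, hH.eigenvalues j = ∑ i, B i j * x i := by
    intro j
    have h1 : star U * (∑ i, (x i : ℂ) • A i) * U =
        Matrix.diagonal (RCLike.ofReal ∘ hH.eigenvalues) := by
      rw [← hH.conjStarAlgAut_star_eigenvectorUnitary, Unitary.conjStarAlgAut_star_apply]
    rw [Matrix.mul_sum, Matrix.sum_mul] at h1
    have h2 := congrArg (fun M => (M j j).re) h1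
    simp only [Matrix.sum_apply, Matrix.mul_smul, Matrix.smul_mul, Matrix.smul_apply,
      Complex.re_sum, smul_eq_mul, Complex.re_ofReal_mul, Matrix.diagonal_apply_eq,
      Function.comp_apply] at h2
    rw [show hH.eigenvalues j = ((RCLike.ofReal (hH.eigenvalues j) : ℂ)).re from rfl, ← h2]
    exact Finset.sum_congr rfl fun i _ => mul_comm _ _
  rw [hH.det_eq_prod_eigenvalues]
  have hle : ∏ i, x i ≤ ∏ j, hH.eigenvalues j := by
    calc ∏ i, x i = ∏ i, ∏ j, x i ^ B i j := by
          refine Finset.prod_congr rfl fun i _ => ?_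
          rw [← Real.rpow_sum_of_pos (hx i), hrow, Real.rpow_one]
      _ = ∏ j, ∏ i, x i ^ B i j := Finset.prod_comm
      _ ≤ ∏ j, hH.eigenvalues j := by
          refine Finset.prod_le_prod
            (fun j _ => Finset.prod_nonneg fun i _ => Real.rpow_nonneg (hx i).le _) fun j _ => ?_
          rw [heig]
          exact Real.geom_mean_le_arith_mean_weighted Finset.univ (fun i => B i j) x
            (fun i _ => hB0 i j) (hcol j) (fun i _ => (hx i).le)
  have hcast : ∏ j, ((hH.eigenvalues j : ℝ) : ℂ) = ((∏ j, hH.eigenvalues j : ℝ) : ℂ) := by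
    push_cast
    rfl
  exact (Complex.real_le_real.2 hle).trans hcast.ge

/-- The lower bound for mixed discriminants; the rank bound is needed for the first `n - k`
matrices only. -/
theorem IsDoublyStochasticTuple.le_mixedDiscriminant (hA : IsDoublyStochasticTuple A) {k : ℕ}
    (hkn : k ≤ n) (hrank : ∀ i : Fin n, (i : ℕ) < n - k → (A i).rank ≤ k) :
    (((((k : ℝ) - 1) / k) ^ ((k - 1) * (n - k)) * ((k.factorial : ℝ) / (k : ℝ) ^ k) : ℝ) : ℂ) ≤
      mixedDiscriminant A := by
  have hk : n = 0 ∨ 1 ≤ k := by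
    by_contra! h
    obtain rfl : k = 0 := by omega
    -- A matrix of rank zero does not have trace one.
    let i : Fin n := ⟨0, by omega⟩
    have hH := (hA.posSemidef i).isHermitian
    have h0 := Nat.le_zero.1 (hrank i (by simp only [i]; omega))
    rw [hH.rank_eq_card_non_zero_eigs, Fintype.card_eq_zero_iff, isEmpty_subtype] at h0
    simp only [not_not] at h0
    have := hA.trace_eq_one i
    simp [hH.trace_eq_sum_eigenvalues, h0] at this
  have := hA.isStable.le_coeff_one (isHomogeneous_detPolynomial A) one_pos hA.capacityGE_one hkn hk
    fun i hi => (degreeOf_detPolynomial_le_rank A i (hA.posSemidef i).isHermitian).trans (hrank i hi)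
  rwa [one_mul, gurvitsFactor, ← pow_mul, ← mixedDiscriminant_eq_coeff] at this

end DetPolynomial

/-! ### Permanents -/

section Permanent

variable {n : ℕ}

theorem sum_single_eq_one_iff_bijective (g : Fin n → Fin n) :
    (∑ j, Finsupp.single (g j) 1 = Finsupp.equivFunOnFinite.symm fun _ : Fin n => (1 : ℕ)) ↔
      g.Bijective := by
  constructor
  · intro h
    rw [← Finite.surjective_iff_bijective]
    intro i
    by_contra! hi
    have := DFunLike.congr_fun h i
    rw [Finsupp.finsetSum_apply, Finset.sum_eq_zero fun j _ => by
      rw [Finsupp.single_apply, if_neg (hi j)]] at this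
    simp at this
  · intro h
    rw [h.sum_comp fun i => Finsupp.single i 1]
    ext i
    simp [Finsupp.finsetSum_apply, Finsupp.single_apply]

/-- The permanent is the mixed discriminant of the diagonal matrices formed from the rows. -/
theorem mixedDiscriminant_diagonal (A : Matrix (Fin n) (Fin n) ℂ) :
    mixedDiscriminant (fun i => Matrix.diagonal (A i)) = A.permanent := by
  have hdet : detPolynomial (fun i => Matrix.diagonal (A i)) =
      ∏ j, ∑ i, MvPolynomial.X i * MvPolynomial.C (A i j) := by
    rw [← Matrix.det_diagonal, detPolynomial]
    congr 1
    ext1 a b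
    by_cases h : a = b
    · subst h
      simp [Matrix.sum_apply]
    · simp [Matrix.sum_apply, h]
  rw [mixedDiscriminant_eq_coeff, hdet, Finset.prod_univ_sum, MvPolynomial.coeff_sum,
    Fintype.piFinset_univ, Matrix.permanent]
  have hterm : ∀ g : Fin n → Fin n,
      MvPolynomial.coeff (Finsupp.equivFunOnFinite.symm fun _ => 1)
        (∏ j, MvPolynomial.X (g j) * MvPolynomial.C (A (g j) j)) =
      if g.Bijective then ∏ j, A (g j) j else 0 := by
    intro g
    have : ∏ j, MvPolynomial.X (g j) * MvPolynomial.C (A (g j) j) =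
        MvPolynomial.monomial (∑ j, Finsupp.single (g j) 1) (∏ j, A (g j) j) := by
      rw [MvPolynomial.monomial_sum_index]
      simp [Finset.prod_mul_distrib, MvPolynomial.X, mul_comm]
    classical
    rw [this, MvPolynomial.coeff_monomial]
    simp only [sum_single_eq_one_iff_bijective]
  rw [Finset.sum_congr rfl fun g _ => hterm g, ← Finset.sum_filter]
  refine Finset.sum_bij' (fun g hg => Equiv.ofBijective g (Finset.mem_filter.1 hg).2)
    (fun s _ => s) ?_ ?_ ?_ ?_ ?_
  · simp
  · intro s _
    exact Finset.mem_filter.2 ⟨Finset.mem_univ _, s.bijective⟩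
  · simp
  · intro s _
    ext
    simp
  · simp

theorem isDoublyStochasticTuple_diagonal {A : Matrix (Fin n) (Fin n) ℝ}
    (hA : A ∈ doublyStochastic ℝ (Fin n)) :
    IsDoublyStochasticTuple fun i => Matrix.diagonal fun j => (A i j : ℂ) where
  posSemidef i := by
    rw [Matrix.posSemidef_diagonal_iff]
    intro j
    exact_mod_cast nonneg_of_mem_doublyStochastic hA
  trace_eq_one i := by
    rw [Matrix.trace_diagonal]
    exact_mod_cast sum_row_of_mem_doublyStochastic hA i
  sum_eq_one := by
    ext a b
    rw [Matrix.sum_apply]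
    by_cases h : a = b
    · subst h
      simp only [Matrix.diagonal_apply_eq, Matrix.one_apply_eq]
      exact_mod_cast sum_col_of_mem_doublyStochastic hA a
    · simp [h]

end Permanent

theorem corollary2p15 (n k : ℕ) (hkn : k ≤ n) :
    (∀ A : Fin n → Matrix (Fin n) (Fin n) ℂ,
      IsDoublyStochasticTuple A → (∀ i, (A i).rank ≤ k) →
        (mixedDiscriminant A).im = 0 ∧
        (((k : ℝ) - 1) / k) ^ ((k - 1) * (n - k)) * ((k.factorial : ℝ) / (k : ℝ) ^ k) ≤
          (mixedDiscriminant A).re) ∧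
    (∀ A : Matrix (Fin n) (Fin n) ℝ,
      A ∈ doublyStochastic ℝ (Fin n) →
      (∀ i : Fin n, (i : ℕ) < n - k → {j : Fin n | 0 < A i j}.ncard ≤ k) →
        (((k : ℝ) - 1) / k) ^ ((k - 1) * (n - k)) * ((k.factorial : ℝ) / (k : ℝ) ^ k) ≤
          A.permanent) := by
  refine ⟨fun A hA hrank => ?_, fun A hA hsupp => ?_⟩
  · have := Complex.le_def.1 (hA.le_mixedDiscriminant hkn fun i _ => hrank i)
    exact ⟨this.2.symm, this.1⟩
  · have h := (isDoublyStochasticTuple_diagonal hA).le_mixedDiscriminant hkn fun i hi => by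
      rw [Matrix.rank_diagonal, Fintype.card_subtype, ← Set.ncard_coe_finset]
      convert hsupp i hi using 2
      ext j
      simp [(nonneg_of_mem_doublyStochastic hA (i := i) (j := j)).lt_iff_ne, eq_comm]
    have hperm : mixedDiscriminant (fun i => Matrix.diagonal fun j => (A i j : ℂ)) =
        ((A.permanent : ℝ) : ℂ) := by
      rw [mixedDiscriminant_diagonal fun i j => (A i j : ℂ)]
      simp [Matrix.permanent]
    rw [hperm] at h
    exact Complex.real_le_real.1 h
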